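/- Let $ABC$ be a nondegenerate triangle in the Euclidean plane with circumcircle $\Omega$. Let $P\neq P'$ be points of the plane lying on none of the side lines $AB$, $BC$, $CA$ that are isogonal conjugates in $ABC$: at each vertex, the lines joining it to $P$ and to $P'$ are reflections of each other in the angle bisector. For points $U,V$ such that $A,B,C,U,V$ are distinct and no four of them are collinear, $(ABCUV)$ denotes the conic through these five points. Suppose that $\Omega$ meets $(ABCPP')$ at a point $D\neq A,B,C$. Let the lines $DP$ and $DP'$ meet $\Omega$ again at $X$ and $Y$ respectively, suppose that $P,X,Y$ are not collinear, let $\gamma=(PXY)$ be the circle through them, and let $\gamma$ meet the line $PP'$ again at $Z$. (If a line through a point of a circle is tangent to the circle there, it is understood to meet the circle again at the same point.) Then: (a) If $Z\neq P$, then $\gamma$ is tangent to the conic $(ABCPZ)$ at both $P$ and $Z$. (b) If $\gamma$ meets the conic $(ABCPX)$ at two distinct points $Z_1,Z_2$ other than $P$ and $X$, and the lines $XZ_1$, $XZ_2$ meet $\Omega$ again at $Z_1'$, $Z_2'$ respectively, then the line $Z_1'Z_2'$ is tangent to the conic $(ABCPP')$ at $P'$. -/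

import Mathlib

open EuclideanGeometry Module

/-- The Euclidean plane. -/
abbrev Plane : Type := EuclideanSpace ℝ (Fin 2)

instance Plane.factFinrank : Fact (finrank ℝ Plane = 2) := ⟨finrank_euclideanSpace_fin⟩

/-- The standard (counterclockwise) orientation of the plane, used to measure directed angles. -/
noncomputable instance Plane.oriented : Module.Oriented ℝ Plane (Fin 2) :=
  ⟨(EuclideanSpace.basisFun (Fin 2) ℝ).toBasis.orientation⟩

/-- Equality of the directed angles `∠ P Q R` and `∠ S T U` modulo `180°`: twice the angles agree
modulo `360°`. -/
def EqDirectedAngle (P Q R S T U : Plane) : Prop :=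
  (2 : ℤ) • ∡ P Q R = (2 : ℤ) • ∡ S T U

/-- `P` lies on none of the side lines of the triangle `ABC`. -/
def OffSides (A B C P : Plane) : Prop :=
  P ∉ line[ℝ, A, B] ∧ P ∉ line[ℝ, B, C] ∧ P ∉ line[ℝ, C, A]

/-- `P` and `P'` are isogonal conjugates in the triangle `ABC`: at each vertex, the lines to `P`
and to `P'` are mirror images of each other in the angle bisector. -/
structure IsIsogonalConjugate (A B C P P' : Plane) : Prop where
  offSides_left : OffSides A B C P
  offSides_right : OffSides A B C P'
  angle_A : EqDirectedAngle B A P P' A C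
  angle_B : EqDirectedAngle C B P P' B A
  angle_C : EqDirectedAngle A C P P' C B

/-- A conic: a plane curve of degree two
`xx * x² + xy * x * y + yy * y² + x * x + y * y + k = 0`. Degenerate conics are allowed. -/
structure Conic where
  xx : ℝ
  xy : ℝ
  yy : ℝ
  x : ℝ
  y : ℝ
  k : ℝ
  quadratic : xx ≠ 0 ∨ xy ≠ 0 ∨ yy ≠ 0

namespace Conic

/-- The value at a point of the polynomial defining a conic. -/
def eval (K : Conic) (p : Plane) : ℝ :=
  K.xx * p 0 ^ 2 + K.xy * (p 0 * p 1) + K.yy * p 1 ^ 2 + K.x * p 0 + K.y * p 1 + K.k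

instance : Membership Plane Conic := ⟨fun K p => K.eval p = 0⟩

/-- The partial derivative of `K.eval` in the first coordinate. -/
def gradX (K : Conic) (p : Plane) : ℝ := 2 * K.xx * p 0 + K.xy * p 1 + K.x

/-- The partial derivative of `K.eval` in the second coordinate. -/
def gradY (K : Conic) (p : Plane) : ℝ := K.xy * p 0 + 2 * K.yy * p 1 + K.y

/-- The conic passes through `p`, is smooth there, and `l` is its tangent line at `p`. -/
structure IsTangentLineAt (K : Conic) (p : Plane) (l : AffineSubspace ℝ Plane) : Prop where
  mem : p ∈ K
  smooth : K.gradX p ≠ 0 ∨ K.gradY p ≠ 0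
  mem_line_iff : ∀ q : Plane,
    q ∈ l ↔ K.gradX p * (q 0 - p 0) + K.gradY p * (q 1 - p 1) = 0

/-- A conic and a circle are tangent at `p`: both pass through `p` and they have a common tangent
line there. -/
def IsTangentToCircleAt (K : Conic) (s : Sphere Plane) (p : Plane) : Prop :=
  ∃ l : AffineSubspace ℝ Plane, K.IsTangentLineAt p l ∧ s.IsTangentAt p l

/-- The conic passes through the five given points. -/
def Through (K : Conic) (p q r s t : Plane) : Prop :=
  p ∈ K ∧ q ∈ K ∧ r ∈ K ∧ s ∈ K ∧ t ∈ K

end Conic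

/-- `s` is the circumcircle of the (nondegenerate) triangle `PQR`. -/
def IsCircumcircle (s : Sphere Plane) (P Q R : Plane) : Prop :=
  AffineIndependent ℝ ![P, Q, R] ∧ P ∈ s ∧ Q ∈ s ∧ R ∈ s

/-- `R` is the second intersection with the circle `s` of the line through the distinct points `P`
and `Q`, where `P` lies on `s`. If the line is tangent to `s` at `P`, then `R = P`. -/
def IsSecondIntersection (s : Sphere Plane) (P Q R : Plane) : Prop :=
  P ∈ s ∧ P ≠ Q ∧ R = s.secondInter P (Q -ᵥ P)

/-! Take `Ω` as the unit circle, denote points by complex numbers and conjugates by bars, and let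
e₁, e₂, e₃ be the elementary symmetric functions of a, b, c. Isogonal conjugacy of p and q becomes
e₁ = p + q + e₃p̄q̄ and e₂ = e₃(p̄ + q̄) + pq (`isogonal_vertex`, `isogonal_relations`). On the unit
circle a conic restricts to a quartic, so a conic through a, b, c, d is known up to scale except for
its zz̄-coefficient, and a point p on it forces that coefficient to be e₃q̄ + dq
(`conic_coeff_of_isogonal`). For the conic through both p and q the two values agree, which gives q
- p = g(p̄ - q̄) with g = e₃/d: lines parallel to `PP'` have the form z + gz̄ = const.

(a) At each vertex the power with respect to `γ` is the same multiple μ of ℓ², where ℓ is an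
equation of `PP'` (`circle_eval_vertex`). The conic γ - μℓ² = 0 thus passes through `A`, `B`, `C`
and has double contact with `γ` on ℓ = 0. `Conic.grad_eq_of_pencil` shows that every conic through
`A`, `B`, `C`, `P`, `Z` is a nonzero multiple of it.

(b) The pencil spanned by `γ` and the conic `ABCPX` contains a line pair: `PX` and a parallel to
`PP'` (`common_points_collinear`). Hence `Z₁`, `Z₂` lie on that parallel. Projection from `X`
carries `γ` to `Ω` by a spiral similarity centred at `Y`, and this similarity takes the parallel to
the tangent of `ABCPP'` at `P'` (`tangent_eval_eq_zero`). -/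

open scoped ComplexConjugate

/-! ### Unit-circle coordinates and second intersections. -/

/-- The complex coordinate of the plane in which the circle `s` becomes the unit circle. -/
noncomputable def unitCoord (s : Sphere Plane) (q : Plane) : ℂ :=
  ⟨(q 0 - s.center 0) / s.radius, (q 1 - s.center 1) / s.radius⟩

theorem Plane.mem_sphere_iff {s : Sphere Plane} (hs : 0 < s.radius) {q : Plane} :
    q ∈ s ↔ (q 0 - s.center 0) ^ 2 + (q 1 - s.center 1) ^ 2 = s.radius ^ 2 := by
  rw [mem_sphere, EuclideanSpace.dist_eq, Real.sqrt_eq_iff_eq_sq (by positivity) hs.le]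
  simp [Real.dist_eq, Fin.sum_univ_two, sq_abs]

theorem Plane.ext' {p q : Plane} (h0 : p 0 = q 0) (h1 : p 1 = q 1) : p = q := by
  ext i
  fin_cases i
  · exact h0
  · exact h1

theorem unitCoord_injective {s : Sphere Plane} (hs : 0 < s.radius) :
    Function.Injective (unitCoord s) := by
  intro p q h
  have h0 := congrArg Complex.re h
  have h1 := congrArg Complex.im h
  simp only [unitCoord] at h0 h1
  rw [div_left_inj' hs.ne'] at h0 h1
  exact Plane.ext' (by linarith) (by linarith)

theorem unitCoord_mul_conj {s : Sphere Plane} (hs : 0 < s.radius) {q : Plane} (hq : q ∈ s) :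
    unitCoord s q * conj (unitCoord s q) = 1 := by
  rw [Plane.mem_sphere_iff hs] at hq
  have hs' := hs.ne'
  rw [Complex.mul_conj]
  norm_cast
  simp only [unitCoord, Complex.normSq_mk]
  field_simp
  linear_combination hq

/-- The coordinate of a plane point over the reals, in terms of its unit-circle coordinate. -/
theorem coord_eq_unitCoord {s : Sphere Plane} (hs : 0 < s.radius) (q : Plane) :
    ((q 0 : ℝ) : ℂ) = s.center 0 + s.radius * ((unitCoord s q + conj (unitCoord s q)) / 2) ∧
    ((q 1 : ℝ) : ℂ) = s.center 1 +
      s.radius * (-Complex.I * (unitCoord s q - conj (unitCoord s q)) / 2) := by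
  have hs' := hs.ne'
  constructor
  · apply Complex.ext <;> simp [unitCoord]
    field_simp
    ring
  · apply Complex.ext <;> simp [unitCoord]
    field_simp
    ring

theorem unitCoord_sub {s : Sphere Plane} (p q : Plane) :
    unitCoord s p - unitCoord s q = ⟨(p 0 - q 0) / s.radius, (p 1 - q 1) / s.radius⟩ := by
  apply Complex.ext <;> simp [unitCoord] <;> ring

theorem Plane.inner_eq (x y : Plane) : inner ℝ x y = x 0 * y 0 + x 1 * y 1 := by
  simp [PiLp.inner_apply, Fin.sum_univ_two]
  ring

/-- The chord joining p and r on the unit circle is z + prz̄ = p + r; this is that equation at z =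
q, solved for r. Without division it also covers tangency, where r = p. -/
theorem unitCoord_secondInter {s : Sphere Plane} (hs : 0 < s.radius) {P Q R : Plane}
    (h : IsSecondIntersection s P Q R) :
    unitCoord s R * (1 - unitCoord s P * conj (unitCoord s Q)) =
      unitCoord s Q - unitCoord s P := by
  obtain ⟨hP, hPQ, rfl⟩ := h
  have hP1 := unitCoord_mul_conj hs hP
  have hs' := hs.ne'
  set k : ℝ := -2 * inner ℝ (Q -ᵥ P) (P -ᵥ s.center) / inner ℝ (Q -ᵥ P) (Q -ᵥ P) with hk
  have hR : unitCoord s (s.secondInter P (Q -ᵥ P)) =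
      unitCoord s P + k * (unitCoord s Q - unitCoord s P) := by
    rw [Sphere.secondInter, ← hk, unitCoord_sub]
    apply Complex.ext <;> simp [unitCoord] <;> ring
  have hne : inner ℝ (Q -ᵥ P) (Q -ᵥ P) ≠ 0 := by
    simpa [inner_self_eq_zero, sub_eq_zero] using hPQ.symm
  have hk' : k * inner ℝ (Q -ᵥ P) (Q -ᵥ P) = -2 * inner ℝ (Q -ᵥ P) (P -ᵥ s.center) := by
    rw [hk]; field_simp
  -- Twice the real inner product of u and v is uv̄ + ūv.
  have hkC : (k : ℂ) * ((unitCoord s Q - unitCoord s P) * conj (unitCoord s Q - unitCoord s P)) =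
      -((unitCoord s Q - unitCoord s P) * conj (unitCoord s P) +
        conj (unitCoord s Q - unitCoord s P) * unitCoord s P) := by
    rw [unitCoord_sub]
    simp only [Plane.inner_eq, vsub_eq_sub, PiLp.sub_apply] at hk'
    apply Complex.ext
    · simp [unitCoord]
      field_simp
      linear_combination hk'
    · simp [unitCoord]
      ring
  rw [hR]
  simp only [map_sub] at hkC
  linear_combination (-unitCoord s P) * hkC +
    (unitCoord s Q - 2 * unitCoord s P - k * (unitCoord s Q - unitCoord s P)) * hP1

/-! ### Directed angles in complex form. -/

theorem Plane.areaForm_eq (x y : Plane) :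
    (Module.Oriented.positiveOrientation : Orientation ℝ Plane (Fin 2)).areaForm x y =
      x 0 * y 1 - x 1 * y 0 := by
  rw [Orientation.areaForm_to_volumeForm, Module.Oriented.positiveOrientation, Plane.oriented,
    Orientation.volumeForm_robust _ (EuclideanSpace.basisFun (Fin 2) ℝ) rfl,
    Basis.det_apply, Matrix.det_fin_two]
  simp [Basis.toMatrix_apply]
  ring

theorem im_mul_conj_eq_zero_of_two_zsmul_arg_eq {u v : ℂ}
    (h : (2 : ℤ) • (u.arg : Real.Angle) = (2 : ℤ) • (v.arg : Real.Angle)) :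
    (u * conj v).im = 0 := by
  have hs : Real.sin u.arg * Real.cos v.arg = Real.cos u.arg * Real.sin v.arg := by
    rw [Real.Angle.two_zsmul_eq_iff] at h
    -- The arguments agree or differ by π; in the second case sine and cosine both change sign,
    -- which the relation does not see.
    rcases h with h | h
    · have h1 := congrArg Real.Angle.sin h
      have h2 := congrArg Real.Angle.cos h
      simp only [Real.Angle.sin_coe, Real.Angle.cos_coe] at h1 h2
      rw [h1, h2]; ring
    · have h1 := congrArg Real.Angle.sin h
      have h2 := congrArg Real.Angle.cos h
      simp only [Real.Angle.sin_add_pi, Real.Angle.cos_add_pi, Real.Angle.sin_coe,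
        Real.Angle.cos_coe] at h1 h2
      rw [h1, h2]; ring
  have hu := Complex.norm_mul_cos_arg u
  have hu' := Complex.norm_mul_sin_arg u
  have hv := Complex.norm_mul_cos_arg v
  have hv' := Complex.norm_mul_sin_arg v
  simp only [Complex.mul_im, Complex.conj_re, Complex.conj_im]
  rw [← hu, ← hu', ← hv, ← hv']
  linear_combination ‖u‖ * ‖v‖ * hs

theorem EqDirectedAngle.unitCoord {s : Sphere Plane} (hs : 0 < s.radius) {P Q R S T U : Plane}
    (h : EqDirectedAngle P Q R S T U) {p q r p' q' r' : ℂ}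
    (hp : unitCoord s P = p) (hq : unitCoord s Q = q) (hr : unitCoord s R = r)
    (hp' : unitCoord s S = p') (hq' : unitCoord s T = q') (hr' : unitCoord s U = r') :
    (conj p - conj q) * (r - q) * ((p' - q') * (conj r' - conj q')) =
      (p - q) * (conj r - conj q) * ((conj p' - conj q') * (r' - q')) := by
  -- An oriented angle is by definition the argument of the Kähler form, whose real part is the
  -- inner product and whose imaginary part is, up to sign, the area form.
  have key := im_mul_conj_eq_zero_of_two_zsmul_arg_eq h
  have hs' := hs.ne'
  simp only [Orientation.kahler_apply_apply, Plane.areaForm_eq, Plane.inner_eq] at key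
  subst hp hq hr hp' hq' hr'
  simp only [← map_sub, unitCoord_sub]
  simp at key
  apply Complex.ext
  · simp
    ring
  · simp
    field_simp
    linear_combination 2 * key

/-! ### Complex equations of conics and circles. -/

/-- Substitute x = (z + z̄)/2, y = (z - z̄)/2i after rescaling. The last three equations serve to
show that U = V = W = 0 is impossible. -/
theorem Conic.exists_complex_form {s : Sphere Plane} (hs : 0 < s.radius) (K : Conic) :
    ∃ U V W F G k : ℂ,
      (∀ q z Z : _, unitCoord s q = z → conj z = Z →
        (K.eval q : ℂ) = U * z ^ 2 + V * Z ^ 2 + W * (z * Z) + F * z + G * Z + k) ∧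
      (∀ q r z Z w T : _, unitCoord s q = z → conj z = Z → unitCoord s r = w → conj w = T →
        ((K.gradX q * (r 0 - q 0) + K.gradY q * (r 1 - q 1) : ℝ) : ℂ) =
          (2 * U * z + W * Z + F) * (w - z) + (2 * V * Z + W * z + G) * (T - Z)) ∧
      ((K.xx : ℂ) * s.radius ^ 2 = U + V + W ∧ (K.yy : ℂ) * s.radius ^ 2 = W - U - V ∧
        (K.xy : ℂ) * s.radius ^ 2 = 2 * Complex.I * (U - V)) := by
  refine ⟨s.radius ^ 2 * (K.xx - K.yy - Complex.I * K.xy) / 4,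
    s.radius ^ 2 * (K.xx - K.yy + Complex.I * K.xy) / 4,
    s.radius ^ 2 * (K.xx + K.yy) / 2,
    s.radius * (K.gradX s.center - Complex.I * K.gradY s.center) / 2,
    s.radius * (K.gradX s.center + Complex.I * K.gradY s.center) / 2,
    K.eval s.center, ?_, ?_, ?_, ?_, ?_⟩
  · rintro q z Z rfl rfl
    obtain ⟨h0, h1⟩ := coord_eq_unitCoord hs q
    simp only [Conic.eval, Conic.gradX, Conic.gradY]
    push_cast
    rw [h0, h1]
    ring_nf
    simp only [Complex.I_sq]
    ring
  · rintro q r z Z w T rfl rfl rfl rfl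
    obtain ⟨h0, h1⟩ := coord_eq_unitCoord hs q
    obtain ⟨h2, h3⟩ := coord_eq_unitCoord hs r
    simp only [Conic.gradX, Conic.gradY]
    push_cast
    rw [h0, h1, h2, h3]
    ring_nf
    simp only [Complex.I_sq]
    ring
  · ring
  · ring
  · ring_nf
    simp only [Complex.I_sq]
    ring

theorem Sphere.exists_complex_form {s : Sphere Plane} (hs : 0 < s.radius) (t : Sphere Plane) :
    ∃ F G k : ℂ, ∀ q z Z : _, unitCoord s q = z → conj z = Z →
      (((q 0 - t.center 0) ^ 2 + (q 1 - t.center 1) ^ 2 - t.radius ^ 2 : ℝ) : ℂ) =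
        s.radius ^ 2 * (z * Z - 1 + F * z + G * Z + k) := by
  have hs' : (s.radius : ℂ) ≠ 0 := by exact_mod_cast hs.ne'
  refine ⟨((s.center 0 - t.center 0) - Complex.I * (s.center 1 - t.center 1)) / s.radius,
    ((s.center 0 - t.center 0) + Complex.I * (s.center 1 - t.center 1)) / s.radius,
    1 + ((s.center 0 - t.center 0) ^ 2 + (s.center 1 - t.center 1) ^ 2 - t.radius ^ 2)
      / s.radius ^ 2, ?_⟩
  rintro q z Z rfl rfl
  obtain ⟨h0, h1⟩ := coord_eq_unitCoord hs q
  push_cast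
  rw [h0, h1]
  field_simp
  ring_nf
  simp only [Complex.I_sq]
  ring

/-! ### Polynomial identities, with z̄ treated as an independent variable (the capital letter). -/

section Algebra

variable {k : Type*} [Field k]

/-- The angle condition of isogonal conjugation at the vertex `a`, all vertices on the unit
circle. -/
theorem isogonal_vertex {a b c A B C p P q Q : k} (hA : a * A = 1) (hB : b * B = 1)
    (hC : c * C = 1) (hab : a ≠ b) (hac : a ≠ c)
    (h : (B - A) * (p - a) * ((q - a) * (C - A)) = (b - a) * (P - A) * ((Q - A) * (c - a))) :
    (p * q + a * b * c * (P + Q) - (a * b + b * c + c * a)) =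
      a * (p + q + a * b * c * (P * Q) - (a + b + c)) := by
  have ha : a ≠ 0 := left_ne_zero_of_mul_eq_one hA
  have hb : b ≠ 0 := left_ne_zero_of_mul_eq_one hB
  have hc : c ≠ 0 := left_ne_zero_of_mul_eq_one hC
  obtain rfl : A = a⁻¹ := eq_inv_of_mul_eq_one_right hA
  obtain rfl : B = b⁻¹ := eq_inv_of_mul_eq_one_right hB
  obtain rfl : C = c⁻¹ := eq_inv_of_mul_eq_one_right hC
  have h1 : a - b ≠ 0 := sub_ne_zero.2 hab
  have h2 : a - c ≠ 0 := sub_ne_zero.2 hac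
  field_simp at h
  -- With denominators cleared, the angle condition carries the spurious factor (a - b)(a - c).
  have h3 : (a - b) * (a - c) * ((p * q + a * b * c * (P + Q) - (a * b + b * c + c * a)) -
      a * (p + q + a * b * c * (P * Q) - (a + b + c))) = 0 := by
    linear_combination h
  simpa [h1, h2, sub_eq_zero] using h3

/-- The conditions at two vertices read N = aM = bM with the same M and N, so M = N = 0. -/
theorem isogonal_relations {a b e₁ e₂ e₃ p P q Q : k} (hab : a ≠ b)
    (h₁ : p * q + e₃ * (P + Q) - e₂ = a * (p + q + e₃ * (P * Q) - e₁))
    (h₂ : p * q + e₃ * (P + Q) - e₂ = b * (p + q + e₃ * (P * Q) - e₁)) :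
    e₁ = p + q + e₃ * (P * Q) ∧ e₂ = e₃ * (P + Q) + p * q := by
  have h : (a - b) * (p + q + e₃ * (P * Q) - e₁) = 0 := by linear_combination h₂ - h₁
  have h' := (mul_eq_zero.1 h).resolve_left (sub_ne_zero.2 hab)
  exact ⟨by linear_combination -h', by linear_combination -a * h' - h₁⟩

/-- A point with an isogonal conjugate is either off the circumcircle or a vertex. -/
theorem vertex_of_isogonal_of_unit {a b c p P q Q : k}
    (h₁ : a + b + c = p + q + a * b * c * (P * Q))
    (h₂ : a * b + b * c + c * a = a * b * c * (P + Q) + p * q) (h : p * P = 1) :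
    p = a ∨ p = b ∨ p = c := by
  -- With P = 1/p the two relations say that p is a root of the cubic whose roots are the vertices.
  have : (p - a) * ((p - b) * (p - c)) = 0 := by
    linear_combination (-p ^ 2) * h₁ + p * h₂ + (a * b * c - p * a * b * c * Q) * h
  simpa [sub_eq_zero] using this

/-- The complex form of a conic through four points of the unit circle. -/
theorem conic_coeffs_of_four_unit {a b c d A B C D U V W F G m : k}
    (hA : a * A = 1) (hB : b * B = 1) (hC : c * C = 1) (hD : d * D = 1)
    (hab : a ≠ b) (hbc : b ≠ c) (hca : c ≠ a) (hda : d ≠ a) (hdb : d ≠ b) (hdc : d ≠ c)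
    (ha : U * a ^ 2 + V * A ^ 2 + W * (a * A) + F * a + G * A + m = 0)
    (hb : U * b ^ 2 + V * B ^ 2 + W * (b * B) + F * b + G * B + m = 0)
    (hc : U * c ^ 2 + V * C ^ 2 + W * (c * C) + F * c + G * C + m = 0)
    (hd : U * d ^ 2 + V * D ^ 2 + W * (d * D) + F * d + G * D + m = 0) :
    V = U * (a * b * c * d) ∧ F = -(U * (a + b + c + d)) ∧
      G = -(U * (a * b * c + d * (a * b + b * c + c * a))) ∧
      m = U * (a * b + b * c + c * a + d * (a + b + c)) - W := by
  -- On the unit circle Z = 1/z, so z² times the equation is a quartic in z. Repeated divided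
  -- differences at its roots a, b, c, d then yield Vieta's formulas.
  have quart : ∀ z Z : k, z * Z = 1 →
      U * z ^ 2 + V * Z ^ 2 + W * (z * Z) + F * z + G * Z + m = 0 →
      U * z ^ 4 + F * z ^ 3 + (W + m) * z ^ 2 + G * z + V = 0 := by
    intro z Z hz h
    linear_combination z ^ 2 * h - (V * (z * Z + 1) + W * z ^ 2 + G * z) * hz
  have qa := quart a A hA ha
  have qb := quart b B hB hb
  have qc := quart c C hC hc
  have qd := quart d D hD hd
  have dd : ∀ z : k, z ≠ a → U * z ^ 4 + F * z ^ 3 + (W + m) * z ^ 2 + G * z + V = 0 →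
      U * (z ^ 3 + z ^ 2 * a + z * a ^ 2 + a ^ 3) + F * (z ^ 2 + z * a + a ^ 2) +
        (W + m) * (z + a) + G = 0 := by
    intro z hz h
    refine (mul_eq_zero.1 ?_).resolve_left (sub_ne_zero.2 hz)
    linear_combination h - qa
  have rb := dd b hab.symm qb
  have rc := dd c hca qc
  have rd := dd d hda qd
  have dd' : ∀ z : k, z ≠ b → U * (z ^ 3 + z ^ 2 * a + z * a ^ 2 + a ^ 3) +
      F * (z ^ 2 + z * a + a ^ 2) + (W + m) * (z + a) + G = 0 →
      U * (z ^ 2 + z * b + b ^ 2 + z * a + b * a + a ^ 2) + F * (z + b + a) + (W + m) = 0 := by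
    intro z hz h
    refine (mul_eq_zero.1 ?_).resolve_left (sub_ne_zero.2 hz)
    linear_combination h - rb
  have sc := dd' c hbc.symm rc
  have sd := dd' d hdb rd
  have hF : F = -(U * (a + b + c + d)) := by
    have : U * (d + c + b + a) + F = 0 := by
      refine (mul_eq_zero.1 ?_).resolve_left (sub_ne_zero.2 hdc)
      linear_combination sd - sc
    linear_combination this
  subst hF
  have hm : m = U * (a * b + b * c + c * a + d * (a + b + c)) - W := by linear_combination sc
  subst hm
  have hG : G = -(U * (a * b * c + d * (a * b + b * c + c * a))) := by linear_combination rb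
  subst hG
  exact ⟨by linear_combination qa, rfl, rfl, rfl⟩

/-- A conic through `a`, `b`, `c` and a fourth point `d` of the unit circle, and through `p`, has
its last free coefficient determined by the isogonal conjugate `q` of `p`. -/
theorem conic_coeff_of_isogonal {e₁ e₂ e₃ d p P q Q U W : k}
    (h₁ : e₁ = p + q + e₃ * (P * Q)) (h₂ : e₂ = e₃ * (P + Q) + p * q) (hp : p * P ≠ 1)
    (h : U * p ^ 2 + U * (e₃ * d) * P ^ 2 + W * (p * P) + -(U * (e₁ + d)) * p +
      -(U * (e₃ + d * e₂)) * P + (U * (e₂ + d * e₁) - W) = 0) :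
    W = U * (e₃ * Q + d * q) := by
  have h3 : (p * P - 1) * (W - U * (e₃ * Q + d * q)) = 0 := by
    subst h₁ h₂
    linear_combination h
  linear_combination (mul_eq_zero.1 h3).resolve_left (sub_ne_zero.2 hp)

/-- The power with respect to a circle through `x`, `y`, as a combination of the unit circle and
the line `xy`. -/
theorem circle_coeffs_of_two_unit {x y X Y F G m : k} (hX : x * X = 1) (hY : y * Y = 1)
    (hxy : x ≠ y) (hx : x * X - 1 + F * x + G * X + m = 0)
    (hy : y * Y - 1 + F * y + G * Y + m = 0) :
    G = F * (x * y) ∧ m = -(F * (x + y)) := by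
  have hG : G = F * (x * y) := by
    have : (x - y) * (G - F * (x * y)) = 0 := by
      linear_combination (-x * y) * hx + (x * y) * hy + (x * y + G * y) * hX
        - (x * y + G * x) * hY
    linear_combination (mul_eq_zero.1 this).resolve_left (sub_ne_zero.2 hxy)
  subst hG
  exact ⟨rfl, by linear_combination hx - (1 + F * y) * hX⟩

/-- Circles through x and y form a pencil with parameter t, and `ht` says that p lies on the circle.
Inserting the formula for x leaves the nonzero factor pP - 1. -/
theorem circle_param {d p P x y t : k}
    (hpP : p * P ≠ 1) (hx : x * (1 - d * P) = p - d)
    (ht : p * P - 1 + t * (p + x * y * P - x - y) = 0) :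
    (d - y) * t = 1 - d * P := by
  have h : (p * P - 1) * ((d - y) * t - (1 - d * P)) = 0 := by
    linear_combination (-(1 - d * P)) * ht + t * (y * P - 1) * hx
  linear_combination (mul_eq_zero.1 h).resolve_left (sub_ne_zero.2 hpP)

/-- At a vertex, the power with respect to the circle `PXY` is a fixed multiple of the square of
the equation of the line `PP'`. -/
theorem circle_eval_vertex {a b c A d g p P q Q x y t : k} (hA : a * A = 1)
    (h₁ : a + b + c = p + q + a * b * c * (P * Q))
    (h₂ : a * b + b * c + c * a = a * b * c * (P + Q) + p * q)
    (h₃ : a * b * c = g * d) (hq : q - p = g * (P - Q))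
    (hx : x * (1 - d * P) = p - d) (hy : y * (1 - d * Q) = q - d) :
    (a * A - 1 + t * (a + x * y * A - x - y)) * (g * ((1 - d * P) * (1 - d * Q))) =
      t * d * (a + g * A - p - g * P) ^ 2 := by
  obtain rfl : q = p + g * (P - Q) := by linear_combination hq
  have ha : a ≠ 0 := left_ne_zero_of_mul_eq_one hA
  have hax : (a - x) * (1 - d * P) = a - a * d * P - p + d := by linear_combination -hx
  have hay : (a - y) * (1 - d * Q) = a - a * d * Q - (p + g * (P - Q)) + d := by
    linear_combination -hy
  -- The polynomial with roots a, b, c, evaluated at a, with its coefficients rewritten through p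
  -- and q. The identity `key` holds modulo this cubic.
  have cubic : a ^ 3 - (p + (p + g * (P - Q)) + g * d * (P * Q)) * a ^ 2 +
      (g * d * (P + Q) + p * (p + g * (P - Q))) * a - g * d = 0 := by
    rw [h₃] at h₁ h₂
    rw [← h₁, ← h₂, ← h₃]; ring
  have e : a + x * y * A - x - y = (a - x) * (a - y) * A := by
    linear_combination (x + y - a) * hA
  have key : g * a * ((a - a * d * P - p + d) * (a - a * d * Q - (p + g * (P - Q)) + d)) =
      d * (a ^ 2 - (p + g * P) * a + g) ^ 2 := by
    linear_combination (-(d * a - g)) * cubic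
  have l : a + g * A - p - g * P = A * (a ^ 2 - (p + g * P) * a + g) := by
    linear_combination (p + g * P - a) * hA
  rw [← hax, ← hay] at key
  rw [e, l, hA]
  linear_combination t * A ^ 2 * key -
    t * A * ((a - x) * (a - y)) * (g * ((1 - d * P) * (1 - d * Q))) * hA

/-- The line `PP'` misses the vertices. -/
theorem line_eval_vertex_ne_zero {a b c A d D g p P q Q x y : k} (hA : a * A = 1) (hD : d * D = 1)
    (h₁ : a + b + c = p + q + a * b * c * (P * Q))
    (h₂ : a * b + b * c + c * a = a * b * c * (P + Q) + p * q)
    (h₃ : a * b * c = g * d) (hq : q - p = g * (P - Q)) (hb : b ≠ 0) (hc : c ≠ 0)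
    (hpa : P ≠ A) (hqa : Q ≠ A) (hP : 1 - d * P ≠ 0) (hQ : 1 - d * Q ≠ 0)
    (hx : x * (1 - d * P) = p - d) (hy : y * (1 - d * Q) = q - d) (hxy : x ≠ y) :
    a + g * A - p - g * P ≠ 0 := by
  intro h
  have hp : p - a = -g * (P - A) := by linear_combination -h
  have hq' : q - a = -g * (Q - A) := by linear_combination hq + hp
  have ha : a ≠ 0 := left_ne_zero_of_mul_eq_one hA
  have hd : d ≠ 0 := left_ne_zero_of_mul_eq_one hD
  have hg : g ≠ 0 := by
    rintro rfl
    simp [ha, hb, hc] at h₃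
  have hiso : (p - a) * (q - a) = b * c * ((a * P - 1) * (a * Q - 1)) := by
    linear_combination a * h₁ - h₂
  have h4 : g * (P - A) * (Q - A) * (g - a * d) = 0 := by
    rw [hp, hq'] at hiso
    have e1 : a * P - 1 = a * (P - A) := by linear_combination hA
    have e2 : a * Q - 1 = a * (Q - A) := by linear_combination hA
    rw [e1, e2] at hiso
    linear_combination hiso + a * (P - A) * (Q - A) * h₃
  -- The line `PP'` would thus be parallel to the chord `AD`; as it contains `A`, it would be `AD`
  -- itself, forcing x = y = a.
  have hgd : g = a * d := by
    simpa [hg, sub_eq_zero, hpa, hqa] using h4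
  subst hgd
  apply hxy
  have hxa : x = a := mul_right_cancel₀ hP (by linear_combination hx + hp + d * hA)
  have hya : y = a := mul_right_cancel₀ hQ (by linear_combination hy + hq' + d * hA)
  rw [hxa, hya]

/-- The common points of the circle `PXY` and the conic `ABCPX` other than `P`, `X` lie on a line
parallel to `PP'`. -/
theorem common_points_collinear {e₁ e₂ d g p P q Q x y t z Z : k}
    (h₁ : e₁ = p + q + g * d * (P * Q)) (h₂ : e₂ = g * d * (P + Q) + p * q)
    (hx : x * (1 - d * P) = p - d) (hy : y * (1 - d * Q) = q - d)
    (ht : (d - y) * t = 1 - d * P)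
    (hγ : z * Z - 1 + t * (z + x * y * Z - x - y) = 0)
    (hK : z ^ 2 + g * d * x * Z ^ 2 + (g * d * Q + x * q) * (z * Z) - (e₁ + x) * z -
      (g * d + x * e₂) * Z + (e₂ + x * e₁ - (g * d * Q + x * q)) = 0) :
    (z + x * d * Z - x - d) * (z + g * Z - (e₁ - d - (1 - d * Q) * (g - x * y) * t)) = 0 := by
  have hT : (d - y) * ((1 - d * Q) * (g - x * y) * t) = g + d * e₁ - d ^ 2 - e₂ := by
    subst h₁ h₂
    linear_combination (1 - d * Q) * (g - x * y) * ht - y * (1 - d * Q) * hx - (p - d) * hy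
  -- The multiplier (1 - dQ)(g - xy) of the circle is the one that makes the zZ-coefficient equal to
  -- g + xd, that of the product of the two lines.
  linear_combination hK + (1 - d * Q) * (g - x * y) * hγ + (x * z * Z - x) * hy +
    (x * Z - 1) * hT

/-- A common point of the circle `PXY` and the line `PX` is `P` or `X`. -/
theorem eq_of_circle_of_line {d x X p P F G m z Z : k} (hX : x * X = 1) (hd : d ≠ 0)
    (hp : p * P - 1 + F * p + G * P + m = 0) (hx : x * X - 1 + F * x + G * X + m = 0)
    (hz : z * Z - 1 + F * z + G * Z + m = 0) (hpl : x * (1 - d * P) = p - d) (hpx : p ≠ x)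
    (hzl : z + x * d * Z - x - d = 0) : z = p ∨ z = x := by
  have hx0 : x ≠ 0 := left_ne_zero_of_mul_eq_one hX
  obtain rfl : Z = (x + d - z) / (x * d) := by field_simp; linear_combination hzl
  obtain rfl : P = (x + d - p) / (x * d) := by field_simp; linear_combination -hpl
  obtain rfl : X = x⁻¹ := eq_inv_of_mul_eq_one_right hX
  field_simp at hp hx hz
  have h : (p - x) * ((z - p) * (z - x)) = 0 := by
    linear_combination (z - x) * hp + (p - z) * d * hx - (p - x) * hz
  simpa [sub_eq_zero, hpx] using h

/-- The tangent line at `P'` of the conic `ABCPP'` contains `Z'` as soon as `Z` is on the line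
parallel to `PP'` of `common_points_collinear`. -/
theorem tangent_eval_eq_zero {e₁ e₂ d g p P q Q x y t z Z w T : k}
    (h₁ : e₁ = p + q + g * d * (P * Q)) (h₂ : e₂ = g * d * (P + Q) + p * q)
    (hx : x * (1 - d * P) = p - d) (hy : y * (1 - d * Q) = q - d)
    (ht : (d - y) * t = 1 - d * P)
    (hw : w * (1 + t * x) = z + t * (x * y)) (hT : T * (1 + t * y) = Z + t)
    (hz : z + g * Z - (e₁ - d - (1 - d * Q) * (g - x * y) * t) = 0) :
    (2 * q + (g * d * P + d * p) * Q - (e₁ + d)) * (w - q) +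
      (2 * (g * d * d) * Q + (g * d * P + d * p) * q - (g * d + d * e₂)) * (T - Q) = 0 := by
  -- Both tangent coefficients contain the denominators 1 + tx and 1 + ty of w and T, so the tangent
  -- equation pulls back to an equation in z + gZ.
  have hG : 2 * q + (g * d * P + d * p) * Q - (e₁ + d) =
      -(1 - d * Q) * ((d - y) * (1 + t * x)) := by
    linear_combination -h₁ - hy + (1 - d * Q) * x * ht + (1 - d * Q) * hx
  have hG' : 2 * (g * d * d) * Q + (g * d * P + d * p) * q - (g * d + d * e₂) =
      -(1 - d * Q) * g * ((d - y) * (1 + t * y)) := by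
    linear_combination -d * h₂ - g * d * P * hy + (1 - d * Q) * g * y * ht
  rw [hG, hG']
  linear_combination (-(1 - d * Q) * (d - y)) *
    (hw + g * hT + hz + h₁ + (g * Q - x) * ht - hx + t * x * hy)

end Algebra

/-! ### Lines, triangles and smooth points in real coordinates. -/

theorem Plane.sq_add_sq_ne_zero {A B : Plane} (h : A ≠ B) :
    (B 0 - A 0) ^ 2 + (B 1 - A 1) ^ 2 ≠ 0 := by
  intro h0
  rw [add_eq_zero_iff_of_nonneg (sq_nonneg _) (sq_nonneg _), sq_eq_zero_iff, sq_eq_zero_iff,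
    sub_eq_zero, sub_eq_zero] at h0
  exact h (Plane.ext' h0.1.symm h0.2.symm)

theorem Plane.mem_line_iff {A B : Plane} (h : A ≠ B) {q : Plane} :
    q ∈ line[ℝ, A, B] ↔ (B 0 - A 0) * (q 1 - A 1) - (B 1 - A 1) * (q 0 - A 0) = 0 := by
  rw [mem_affineSpan_pair_iff_exists_lineMap_eq]
  constructor
  · rintro ⟨r, rfl⟩
    simp [AffineMap.lineMap_apply]
    ring
  · intro hq
    have hN := Plane.sq_add_sq_ne_zero h
    refine ⟨((B 0 - A 0) * (q 0 - A 0) + (B 1 - A 1) * (q 1 - A 1)) /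
      ((B 0 - A 0) ^ 2 + (B 1 - A 1) ^ 2), Plane.ext' ?_ ?_⟩
    · simp [AffineMap.lineMap_apply]
      field_simp
      linear_combination (B 1 - A 1) * hq
    · simp [AffineMap.lineMap_apply]
      field_simp
      linear_combination (-(B 0 - A 0)) * hq

theorem IsCircumcircle.ne {s : Sphere Plane} {P Q R : Plane} (h : IsCircumcircle s P Q R) :
    P ≠ Q ∧ Q ≠ R ∧ R ≠ P := by
  refine ⟨fun e => ?_, fun e => ?_, fun e => ?_⟩
  · exact absurd (h.1.injective (a₁ := 0) (a₂ := 1) e) (by decide)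
  · exact absurd (h.1.injective (a₁ := 1) (a₂ := 2) e) (by decide)
  · exact absurd (h.1.injective (a₁ := 2) (a₂ := 0) e) (by decide)

theorem IsCircumcircle.cross_ne_zero {s : Sphere Plane} {P Q R : Plane}
    (h : IsCircumcircle s P Q R) :
    (Q 0 - P 0) * (R 1 - P 1) - (Q 1 - P 1) * (R 0 - P 0) ≠ 0 := by
  rw [Ne, ← Plane.mem_line_iff h.ne.1]
  intro hR
  have h1 := (affineIndependent_iff_not_collinear_set).1 h.1
  apply h1
  have := collinear_insert_of_mem_affineSpan_pair hR
  convert this using 1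
  ext; simp; tauto

theorem EuclideanGeometry.Sphere.radius_pos_of_ne {s : Sphere Plane} {P Q : Plane} (hP : P ∈ s)
    (hQ : Q ∈ s) (h : P ≠ Q) : 0 < s.radius := by
  rw [mem_sphere] at hP hQ
  rcases (dist_nonneg.trans_eq hP).lt_or_eq with h0 | h0
  · exact h0
  · rw [← h0, dist_eq_zero] at hP hQ
    exact absurd (hP.trans hQ.symm) h

theorem IsCircumcircle.radius_pos {s : Sphere Plane} {P Q R : Plane}
    (h : IsCircumcircle s P Q R) : 0 < s.radius :=
  Sphere.radius_pos_of_ne h.2.1 h.2.2.1 h.ne.1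

/-- A binary quadratic form with three pairwise independent null vectors vanishes. -/
theorem quadratic_form_eq_zero {α β γ u₀ u₁ v₀ v₁ w₀ w₁ : ℝ}
    (hu : α * u₀ ^ 2 + β * (u₀ * u₁) + γ * u₁ ^ 2 = 0)
    (hv : α * v₀ ^ 2 + β * (v₀ * v₁) + γ * v₁ ^ 2 = 0)
    (hw : α * w₀ ^ 2 + β * (w₀ * w₁) + γ * w₁ ^ 2 = 0)
    (huv : u₀ * v₁ - u₁ * v₀ ≠ 0) (hvw : v₀ * w₁ - v₁ * w₀ ≠ 0)
    (hwu : w₀ * u₁ - w₁ * u₀ ≠ 0) : α = 0 ∧ β = 0 ∧ γ = 0 := by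
  -- Up to sign, this is the determinant of the linear system for α, β, γ.
  have hD : (u₀ * v₁ - u₁ * v₀) * (v₀ * w₁ - v₁ * w₀) * (w₀ * u₁ - w₁ * u₀) ≠ 0 :=
    mul_ne_zero (mul_ne_zero huv hvw) hwu
  refine ⟨(mul_eq_zero.1 ?_).resolve_left hD, (mul_eq_zero.1 ?_).resolve_left hD,
    (mul_eq_zero.1 ?_).resolve_left hD⟩
  · linear_combination -(v₁ * w₁ * (v₀ * w₁ - v₁ * w₀)) * hu -
      (w₁ * u₁ * (w₀ * u₁ - w₁ * u₀)) * hv - (u₁ * v₁ * (u₀ * v₁ - u₁ * v₀)) * hw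
  · linear_combination (v₀ ^ 2 * w₁ ^ 2 - v₁ ^ 2 * w₀ ^ 2) * hu +
      (w₀ ^ 2 * u₁ ^ 2 - w₁ ^ 2 * u₀ ^ 2) * hv + (u₀ ^ 2 * v₁ ^ 2 - u₁ ^ 2 * v₀ ^ 2) * hw
  · linear_combination -(v₀ * w₀ * (v₀ * w₁ - v₁ * w₀)) * hu -
      (w₀ * u₀ * (w₀ * u₁ - w₁ * u₀)) * hv - (u₀ * v₀ * (u₀ * v₁ - u₁ * v₀)) * hw

/-- A conic through the vertices of a triangle is smooth at each of its points off the sides. -/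
theorem Conic.smooth_of_offSides {K : Conic} {A B C P : Plane} (hAB : A ≠ B) (hBC : B ≠ C)
    (hCA : C ≠ A) (hA : A ∈ K) (hB : B ∈ K) (hC : C ∈ K) (hP : P ∈ K) (h : OffSides A B C P) :
    K.gradX P ≠ 0 ∨ K.gradY P ≠ 0 := by
  by_contra! hg
  obtain ⟨h1, h2, h3⟩ := h
  rw [Plane.mem_line_iff hAB] at h1
  rw [Plane.mem_line_iff hBC] at h2
  rw [Plane.mem_line_iff hCA] at h3
  have hP' : K.eval P = 0 := hP
  -- At a singular point the Taylor expansion is purely quadratic, so the vectors from P to the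
  -- vertices are null; they are pairwise independent because P is off the sides.
  have null : ∀ q : Plane, q ∈ K → K.xx * (q 0 - P 0) ^ 2 +
      K.xy * ((q 0 - P 0) * (q 1 - P 1)) + K.yy * (q 1 - P 1) ^ 2 = 0 := by
    intro q hq
    have hq' : K.eval q = 0 := hq
    obtain ⟨hx, hy⟩ := hg
    simp only [Conic.eval, Conic.gradX, Conic.gradY] at hP' hq' hx hy
    linear_combination hq' - hP' - (q 0 - P 0) * hx - (q 1 - P 1) * hy
  obtain ⟨e1, e2, e3⟩ := quadratic_form_eq_zero (null A hA) (null B hB) (null C hC)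
    (fun e => h1 (by linear_combination e)) (fun e => h2 (by linear_combination e))
    (fun e => h3 (by linear_combination e))
  have := K.quadratic
  simp_all

theorem Plane.mem_line_iff_of_normal {n₀ n₁ : ℝ} (hn : n₀ ≠ 0 ∨ n₁ ≠ 0) {P U V : Plane}
    (hUV : U ≠ V) (hU : n₀ * (U 0 - P 0) + n₁ * (U 1 - P 1) = 0)
    (hV : n₀ * (V 0 - P 0) + n₁ * (V 1 - P 1) = 0) (q : Plane) :
    q ∈ line[ℝ, U, V] ↔ n₀ * (q 0 - P 0) + n₁ * (q 1 - P 1) = 0 := by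
  rw [Plane.mem_line_iff hUV]
  have hN : n₀ ^ 2 + n₁ ^ 2 ≠ 0 := by
    rcases hn with h | h <;> positivity
  set s := n₀ * (V 1 - U 1) - n₁ * (V 0 - U 0) with hs
  have h0 : (n₀ ^ 2 + n₁ ^ 2) * (V 0 - U 0) = -s * n₁ := by
    rw [hs]; linear_combination n₀ * hV - n₀ * hU
  have h1 : (n₀ ^ 2 + n₁ ^ 2) * (V 1 - U 1) = s * n₀ := by
    rw [hs]; linear_combination n₁ * hV - n₁ * hU
  have hs0 : s ≠ 0 := by
    intro e
    rw [e] at h0 h1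
    simp only [neg_zero, zero_mul, mul_eq_zero, hN, false_or, sub_eq_zero] at h0 h1
    exact hUV (Plane.ext' h0.symm h1.symm)
  have key : (n₀ ^ 2 + n₁ ^ 2) *
      ((V 0 - U 0) * (q 1 - U 1) - (V 1 - U 1) * (q 0 - U 0)) =
      -s * (n₀ * (q 0 - P 0) + n₁ * (q 1 - P 1)) := by
    linear_combination (q 1 - U 1) * h0 - (q 0 - U 0) * h1 + s * hU
  constructor
  · intro h
    rw [h, mul_zero] at key
    exact (mul_eq_zero.1 key.symm).resolve_left (neg_ne_zero.2 hs0)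
  · intro h
    rw [h, mul_zero] at key
    exact (mul_eq_zero.1 key).resolve_left hN

/-! ### Double contact of a conic and a circle. -/

/-- The power of a point with respect to a circle, in coordinates. -/
def circleForm (s : Sphere Plane) (q : Plane) : ℝ :=
  (q 0 - s.center 0) ^ 2 + (q 1 - s.center 1) ^ 2 - s.radius ^ 2

/-- An equation of the line through `P` and `Q`. -/
def lineForm (P Q q : Plane) : ℝ :=
  (Q 1 - P 1) * (q 0 - P 0) - (Q 0 - P 0) * (q 1 - P 1)

theorem circleForm_eq_zero_of_mem {s : Sphere Plane} (hs : 0 < s.radius) {q : Plane}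
    (hq : q ∈ s) : circleForm s q = 0 := by
  rw [Plane.mem_sphere_iff hs] at hq
  rw [circleForm, hq, sub_self]

/-- An affine function vanishing at the vertices of a triangle is zero. -/
theorem affine_eq_zero {α β δ : ℝ} {a₀ a₁ b₀ b₁ c₀ c₁ : ℝ}
    (h : (b₀ - a₀) * (c₁ - a₁) - (b₁ - a₁) * (c₀ - a₀) ≠ 0)
    (ha : α * a₀ + β * a₁ + δ = 0) (hb : α * b₀ + β * b₁ + δ = 0)
    (hc : α * c₀ + β * c₁ + δ = 0) : α = 0 ∧ β = 0 ∧ δ = 0 := by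
  have hα : α = 0 := (mul_eq_zero.1 (by
    linear_combination (c₁ - a₁) * (hb - ha) - (b₁ - a₁) * (hc - ha))).resolve_left h
  have hβ : β = 0 := (mul_eq_zero.1 (by
    linear_combination (b₀ - a₀) * (hc - ha) - (c₀ - a₀) * (hb - ha))).resolve_left h
  subst hα hβ
  exact ⟨rfl, rfl, by linarith⟩

/-- If a quadratic polynomial `Q` vanishes on the line through the origin in the direction `(v, w)`
and equals `-ν ℓ ^ 2` at a point off this line, `ℓ` an equation of the line, then the affine cofactor
of `ℓ` in `Q + ν ℓ ^ 2` vanishes at this point. -/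
theorem pencil_affine_factor {α β γ dx dy v w ν X Y : ℝ}
    (hq : α * v ^ 2 + β * (v * w) + γ * w ^ 2 = 0) (hlin : dx * v + dy * w = 0)
    (h : α * X ^ 2 + β * (X * Y) + γ * Y ^ 2 + dx * X + dy * Y + ν * (w * X - v * Y) ^ 2 = 0)
    (hl : w * X - v * Y ≠ 0) :
    (2 * α * v * w + β * (w ^ 2 - v ^ 2) - 2 * γ * v * w) * (v * X + w * Y) +
      (α * w ^ 2 - β * (v * w) + γ * v ^ 2 + ν * (v ^ 2 + w ^ 2) ^ 2) * (w * X - v * Y) +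
      (v ^ 2 + w ^ 2) * (dx * w - dy * v) = 0 := by
  refine (mul_eq_zero.1 ?_).resolve_left hl
  linear_combination (v ^ 2 + w ^ 2) ^ 2 * h - (v * X + w * Y) ^ 2 * hq -
    (v ^ 2 + w ^ 2) * (v * X + w * Y) * hlin

/-- If the powers of `A`, `B`, `C` with respect to a circle are proportional to the squares of their
distances to a line `PP'`, then the conic through `A`, `B`, `C` and the common points `P`, `Z` of the
circle and the line has the same tangents at `P` and `Z` as the circle. -/
theorem Conic.grad_eq_of_pencil {E : Conic} {s : Sphere Plane} {A B C P P' Z : Plane} {μ τ : ℝ}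
    (hABC : (B 0 - A 0) * (C 1 - A 1) - (B 1 - A 1) * (C 0 - A 0) ≠ 0) (hPP' : P ≠ P')
    (hτ : τ ≠ 0) (hZ0 : Z 0 = P 0 + τ * (P' 0 - P 0)) (hZ1 : Z 1 = P 1 + τ * (P' 1 - P 1))
    (hsP : circleForm s P = 0) (hsZ : circleForm s Z = 0)
    (hsA : circleForm s A = μ * lineForm P P' A ^ 2)
    (hsB : circleForm s B = μ * lineForm P P' B ^ 2)
    (hsC : circleForm s C = μ * lineForm P P' C ^ 2)
    (hlA : lineForm P P' A ≠ 0) (hlB : lineForm P P' B ≠ 0) (hlC : lineForm P P' C ≠ 0)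
    (hE : E.Through A B C P Z) :
    ∃ c : ℝ, c ≠ 0 ∧ E.gradX P = c * (P 0 - s.center 0) ∧ E.gradY P = c * (P 1 - s.center 1) ∧
      E.gradX Z = c * (Z 0 - s.center 0) ∧ E.gradY Z = c * (Z 1 - s.center 1) := by
  obtain ⟨hA, hB, hC, hP, hZ⟩ := hE
  change E.eval A = 0 at hA
  change E.eval B = 0 at hB
  change E.eval C = 0 at hC
  change E.eval P = 0 at hP
  change E.eval Z = 0 at hZ
  set v := P' 0 - P 0 with hv
  set w := P' 1 - P 1 with hw
  have hN : v ^ 2 + w ^ 2 ≠ 0 := Plane.sq_add_sq_ne_zero hPP'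
  -- Chosen so that the quadratic part of E - c·γ vanishes in the direction of `PP'`; since this
  -- difference also vanishes at `P` and `Z`, it vanishes on the whole line.
  set c := (E.xx * v ^ 2 + E.xy * (v * w) + E.yy * w ^ 2) / (v ^ 2 + w ^ 2) with hc
  have hcN : c * (v ^ 2 + w ^ 2) = E.xx * v ^ 2 + E.xy * (v * w) + E.yy * w ^ 2 := by
    rw [hc]; field_simp
  clear_value v w c
  obtain ⟨dx, hdx⟩ : ∃ dx, E.gradX P - 2 * c * (P 0 - s.center 0) = dx := ⟨_, rfl⟩
  obtain ⟨dy, hdy⟩ : ∃ dy, E.gradY P - 2 * c * (P 1 - s.center 1) = dy := ⟨_, rfl⟩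
  obtain ⟨α, hα⟩ : ∃ α, E.xx - c = α := ⟨_, rfl⟩
  obtain ⟨γ, hγ⟩ : ∃ γ, E.yy - c = γ := ⟨_, rfl⟩
  have taylor : ∀ q : Plane, E.eval q - c * circleForm s q =
      α * (q 0 - P 0) ^ 2 + E.xy * ((q 0 - P 0) * (q 1 - P 1)) + γ * (q 1 - P 1) ^ 2 +
      dx * (q 0 - P 0) + dy * (q 1 - P 1) := by
    intro q
    subst hdx hdy hα hγ
    simp only [Conic.eval, circleForm, Conic.gradX, Conic.gradY] at hP hsP ⊢
    linear_combination hP - c * hsP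
  have hq : α * v ^ 2 + E.xy * (v * w) + γ * w ^ 2 = 0 := by
    subst hα hγ; linear_combination -hcN
  have hlin : dx * v + dy * w = 0 := by
    have := taylor Z
    rw [hZ, hsZ, hZ0, hZ1] at this
    refine (mul_eq_zero.1 ?_).resolve_left hτ
    linear_combination -this - τ ^ 2 * hq
  -- Up to a constant factor, b, e and f are the coefficients of the affine cofactor m in E - c·γ =
  -- ℓm, in coordinates along and across `PP'`.
  obtain ⟨b, hb⟩ : ∃ b, 2 * α * v * w + E.xy * (w ^ 2 - v ^ 2) - 2 * γ * v * w = b := ⟨_, rfl⟩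
  obtain ⟨e, he⟩ : ∃ e, α * w ^ 2 - E.xy * (v * w) + γ * v ^ 2 = e := ⟨_, rfl⟩
  obtain ⟨f, hf⟩ : ∃ f, (v ^ 2 + w ^ 2) * (dx * w - dy * v) = f := ⟨_, rfl⟩
  have vertex : ∀ q : Plane, E.eval q = 0 → circleForm s q = μ * lineForm P P' q ^ 2 →
      lineForm P P' q ≠ 0 → b * (v * (q 0 - P 0) + w * (q 1 - P 1)) +
        (e + c * μ * (v ^ 2 + w ^ 2) ^ 2) * (w * (q 0 - P 0) - v * (q 1 - P 1)) + f = 0 := by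
    intro q h1 h2 h3
    have h4 := taylor q
    rw [h1, h2] at h4
    simp only [lineForm, ← hv, ← hw] at h3 h4
    subst hb he hf
    exact pencil_affine_factor hq hlin (by linear_combination -h4) h3
  -- At a vertex E = 0 and γ = μℓ² with ℓ ≠ 0, so m + cμℓ, suitably scaled, vanishes there. Being
  -- affine, it vanishes identically.
  obtain ⟨g1, g2, h3⟩ := affine_eq_zero
    (α := b * v + (e + c * μ * (v ^ 2 + w ^ 2) ^ 2) * w)
    (β := b * w - (e + c * μ * (v ^ 2 + w ^ 2) ^ 2) * v) (δ := f)
    (a₀ := A 0 - P 0) (a₁ := A 1 - P 1) (b₀ := B 0 - P 0) (b₁ := B 1 - P 1)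
    (c₀ := C 0 - P 0) (c₁ := C 1 - P 1) (by simpa only [sub_sub_sub_cancel_right] using hABC)
    (by linear_combination vertex A hA hsA hlA) (by linear_combination vertex B hB hsB hlB)
    (by linear_combination vertex C hC hsC hlC)
  have h1 : b = 0 :=
    (mul_eq_zero.1 (by linear_combination v * g1 + w * g2)).resolve_left hN
  have h2 : e + c * μ * (v ^ 2 + w ^ 2) ^ 2 = 0 :=
    (mul_eq_zero.1 (by linear_combination w * g1 - v * g2)).resolve_left hN
  subst hf
  have h4 := (mul_eq_zero.1 h3).resolve_left hN
  have hdx0 : dx = 0 := (mul_eq_zero.1 (by linear_combination w * h4 + v * hlin)).resolve_left hN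
  have hdy0 : dy = 0 := (mul_eq_zero.1 (by linear_combination w * hlin - v * h4)).resolve_left hN
  rw [h1] at hb
  -- The gradient of the quadratic part of E - c·γ vanishes along `PP'`, so the gradient of E - c·γ
  -- is the same at `Z` as at `P`, namely zero.
  have hZx : 2 * α * v + E.xy * w = 0 :=
    (mul_eq_zero.1 (by linear_combination 2 * v * hq + w * hb)).resolve_left hN
  have hZy : E.xy * v + 2 * γ * w = 0 :=
    (mul_eq_zero.1 (by linear_combination 2 * w * hq - v * hb)).resolve_left hN
  refine ⟨2 * c, ?_, by linear_combination hdx + hdx0, by linear_combination hdy + hdy0, ?_, ?_⟩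
  -- If c = 0, then m = 0 as well and E has no quadratic part.
  · intro h0
    have hc0 : c = 0 := by linarith
    rw [hc0] at h2 hα hγ
    have he0 : e = 0 := by linear_combination h2
    rw [he0] at he
    have hα0 : α = 0 := by
      have : (v ^ 2 + w ^ 2) ^ 2 * α = 0 := by
        linear_combination v ^ 2 * hq + w ^ 2 * he + v * w * hb
      exact (mul_eq_zero.1 this).resolve_left (pow_ne_zero 2 hN)
    have hγ0 : γ = 0 := by
      have : (v ^ 2 + w ^ 2) ^ 2 * γ = 0 := by
        linear_combination w ^ 2 * hq + v ^ 2 * he - v * w * hb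
      exact (mul_eq_zero.1 this).resolve_left (pow_ne_zero 2 hN)
    have hxy : E.xy = 0 := by
      rw [hα0] at hZx
      rw [hγ0] at hZy
      exact (mul_eq_zero.1 (by linear_combination v * hZy + w * hZx)).resolve_left hN
    have := E.quadratic
    simp only [sub_zero] at hα hγ
    rw [hα, hγ] at this
    simp_all
  · simp only [Conic.gradX] at hdx ⊢
    rw [hZ0, hZ1]
    subst hα
    linear_combination hdx + hdx0 + τ * hZx
  · simp only [Conic.gradY] at hdy ⊢
    rw [hZ0, hZ1]
    subst hγ
    linear_combination hdy + hdy0 + τ * hZy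

theorem Conic.isTangentToCircleAt_of_grad {E : Conic} {s : Sphere Plane} {P : Plane}
    (hs : 0 < s.radius) (hP : P ∈ E) (hPs : P ∈ s) {c : ℝ} (hc : c ≠ 0)
    (hx : E.gradX P = c * (P 0 - s.center 0)) (hy : E.gradY P = c * (P 1 - s.center 1)) :
    E.IsTangentToCircleAt s P := by
  refine ⟨s.orthRadius P, ⟨hP, ?_, ?_⟩, Sphere.isTangentAt_orthRadius_iff_mem.2 hPs⟩
  · by_contra! h
    rw [hx, hy] at h
    simp only [mul_eq_zero, hc, false_or] at h
    rw [Plane.mem_sphere_iff hs, h.1, h.2] at hPs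
    nlinarith [pow_pos hs 2]
  · intro q
    rw [Sphere.mem_orthRadius_iff_inner_left, Plane.inner_eq, hx, hy]
    simp only [vsub_eq_sub, PiLp.sub_apply]
    constructor
    · intro h
      linear_combination c * h
    · intro h
      refine (mul_eq_zero.1 ?_).resolve_left hc
      linear_combination h

/-! ### The configuration in unit-circle coordinates. -/

/-- If the line through `d` and `p` meets the unit circle again at a vertex, then so does the line
through `d` and `q`. -/
theorem second_inter_eq_vertex {k : Type*} [Field k] {a b c A d g p P q Q : k} (hA : a * A = 1)
    (h₁ : a + b + c = p + q + a * b * c * (P * Q))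
    (h₂ : a * b + b * c + c * a = a * b * c * (P + Q) + p * q)
    (h₃ : a * b * c = g * d) (hq : q - p = g * (P - Q)) (hd : d ≠ 0)
    (hpa : P ≠ A) (hx : a * (1 - d * P) = p - d) :
    a * (1 - d * Q) = q - d := by
  have hiso : (p - a) * (q - a) = b * c * ((a * P - 1) * (a * Q - 1)) := by
    linear_combination a * h₁ - h₂
  have hp : p - a = -a * d * (P - A) := by linear_combination -hx - d * hA
  have h4 : d * (P - A) * (q - a + g * (Q - A)) = 0 := by
    rw [hp, show a * P - 1 = a * (P - A) by linear_combination hA,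
      show a * Q - 1 = a * (Q - A) by linear_combination hA] at hiso
    apply mul_left_cancel₀ (left_ne_zero_of_mul_eq_one hA)
    linear_combination -hiso - a * (P - A) * (Q - A) * h₃
  have h5 : q - a + g * (Q - A) = 0 := by
    simpa [hd, sub_eq_zero, hpa] using h4
  have h6 : (P - A) * (g - a * d) = 0 := by linear_combination -hp - hq + h5
  have hgd : g = a * d := by simpa [sub_eq_zero, hpa] using h6
  subst hgd
  linear_combination -h5 - d * hA

/-- Unit-circle coordinates of a triangle, a pair of isogonal conjugates and the fourth common point
of the circumcircle and the conic through them. -/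
structure IsogonalConfig (a b c d g p q : ℂ) : Prop where
  unit_a : a * conj a = 1
  unit_b : b * conj b = 1
  unit_c : c * conj c = 1
  unit_d : d * conj d = 1
  e₁ : a + b + c = p + q + a * b * c * (conj p * conj q)
  e₂ : a * b + b * c + c * a = a * b * c * (conj p + conj q) + p * q
  e₃ : a * b * c = g * d
  sub_eq : q - p = g * (conj p - conj q)
  unit_p : p * conj p ≠ 1
  unit_q : q * conj q ≠ 1
  left_ne : 1 - d * conj p ≠ 0
  right_ne : 1 - d * conj q ≠ 0

namespace IsogonalConfig

variable {a b c d g p q : ℂ}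

/-- Vertex statements are proved for a alone; rotation carries them to b and c. -/
theorem rotate (h : IsogonalConfig a b c d g p q) : IsogonalConfig b c a d g p q where
  unit_a := h.unit_b
  unit_b := h.unit_c
  unit_c := h.unit_a
  unit_d := h.unit_d
  e₁ := by linear_combination h.e₁
  e₂ := by linear_combination h.e₂
  e₃ := by linear_combination h.e₃
  sub_eq := h.sub_eq
  unit_p := h.unit_p
  unit_q := h.unit_q
  left_ne := h.left_ne
  right_ne := h.right_ne

theorem left_ne_vertex (h : IsogonalConfig a b c d g p q) : conj p ≠ conj a := by
  intro e
  have := (starRingEnd ℂ).injective e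
  subst this
  exact h.unit_p h.unit_a

theorem right_ne_vertex (h : IsogonalConfig a b c d g p q) : conj q ≠ conj a := by
  intro e
  have := (starRingEnd ℂ).injective e
  subst this
  exact h.unit_q h.unit_a

theorem line_eval_ne_zero (h : IsogonalConfig a b c d g p q) {x y : ℂ}
    (hx : x * (1 - d * conj p) = p - d) (hy : y * (1 - d * conj q) = q - d) (hxy : x ≠ y) :
    a + g * conj a - p - g * conj p ≠ 0 :=
  line_eval_vertex_ne_zero h.unit_a h.unit_d h.e₁ h.e₂ h.e₃ h.sub_eq
    (left_ne_zero_of_mul_eq_one h.unit_b) (left_ne_zero_of_mul_eq_one h.unit_c)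
    h.left_ne_vertex h.right_ne_vertex h.left_ne h.right_ne hx hy hxy

theorem second_inter_ne_vertex (h : IsogonalConfig a b c d g p q) {x y : ℂ}
    (hx : x * (1 - d * conj p) = p - d) (hy : y * (1 - d * conj q) = q - d) (hxy : x ≠ y) :
    x ≠ a := by
  rintro rfl
  apply hxy
  have := second_inter_eq_vertex h.unit_a h.e₁ h.e₂ h.e₃ h.sub_eq
    (left_ne_zero_of_mul_eq_one h.unit_d) h.left_ne_vertex hx
  exact mul_right_cancel₀ h.right_ne (this.trans hy.symm)

end IsogonalConfig

/-- The complex form of a conic through four points `A`, `B`, `C`, `D` of a circle and a point `P`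
with isogonal conjugate `P'` in the triangle `ABC`. -/
theorem Conic.form_of_through {s : Sphere Plane} (hs : 0 < s.radius) {K : Conic}
    {A B C D P : Plane} {a b c d p q Q : ℂ} (hA : unitCoord s A = a) (hB : unitCoord s B = b)
    (hC : unitCoord s C = c) (hD : unitCoord s D = d) (hP : unitCoord s P = p)
    (ha : a * conj a = 1) (hb : b * conj b = 1) (hc : c * conj c = 1) (hd : d * conj d = 1)
    (hab : a ≠ b) (hbc : b ≠ c) (hca : c ≠ a) (hda : d ≠ a) (hdb : d ≠ b) (hdc : d ≠ c)
    (h₁ : a + b + c = p + q + a * b * c * (conj p * Q))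
    (h₂ : a * b + b * c + c * a = a * b * c * (conj p + Q) + p * q) (hp : p * conj p ≠ 1)
    (hAK : A ∈ K) (hBK : B ∈ K) (hCK : C ∈ K) (hDK : D ∈ K) (hPK : P ∈ K) :
    ∃ U : ℂ, U ≠ 0 ∧
      (∀ q' z Z : _, unitCoord s q' = z → conj z = Z → (K.eval q' : ℂ) =
        U * (z ^ 2 + a * b * c * d * Z ^ 2 + (a * b * c * Q + d * q) * (z * Z) -
          (a + b + c + d) * z - (a * b * c + d * (a * b + b * c + c * a)) * Z +
          (a * b + b * c + c * a + d * (a + b + c) - (a * b * c * Q + d * q)))) ∧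
      (∀ q' r z Z w T : _, unitCoord s q' = z → conj z = Z → unitCoord s r = w → conj w = T →
        ((K.gradX q' * (r 0 - q' 0) + K.gradY q' * (r 1 - q' 1) : ℝ) : ℂ) =
          U * ((2 * z + (a * b * c * Q + d * q) * Z - (a + b + c + d)) * (w - z) +
            (2 * (a * b * c * d) * Z + (a * b * c * Q + d * q) * z -
              (a * b * c + d * (a * b + b * c + c * a))) * (T - Z))) := by
  obtain ⟨U, V, W, F, G, m, heval, hgrad, hxx, hyy, hxy⟩ := K.exists_complex_form hs
  have zero : ∀ {q' : Plane} {z : ℂ}, unitCoord s q' = z → q' ∈ K →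
      U * z ^ 2 + V * conj z ^ 2 + W * (z * conj z) + F * z + G * conj z + m = 0 := by
    intro q' z hz hq'
    have : K.eval q' = 0 := hq'
    rw [← heval q' z _ hz rfl, this, Complex.ofReal_zero]
  obtain ⟨rfl, rfl, rfl, rfl⟩ := conic_coeffs_of_four_unit ha hb hc hd hab hbc hca hda hdb hdc
    (zero hA hAK) (zero hB hBK) (zero hC hCK) (zero hD hDK)
  have hW : W = U * (a * b * c * Q + d * q) := by
    refine conic_coeff_of_isogonal h₁ h₂ hp ?_
    linear_combination zero hP hPK
  subst hW
  refine ⟨U, ?_, ?_, ?_⟩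
  · rintro rfl
    have hs' : (s.radius : ℂ) ≠ 0 := by exact_mod_cast hs.ne'
    have := K.quadratic
    simp_all
  · intro q' z Z hz hZ
    rw [heval q' z Z hz hZ]
    ring
  · intro q' r z Z w T hz hZ hw hT
    rw [hgrad q' r z Z w T hz hZ hw hT]
    ring

/-- The number g comes from computing the zz̄-coefficient of `H` twice, once from `P` and once from
`P'`. That neither point lies on `Ω` holds because a point of `Ω` satisfying the isogonal relations
is a vertex. -/
theorem isogonalConfig_of_conic {A B C P P' D : Plane} {Ω : Sphere Plane} {H : Conic}
    (hΩ : IsCircumcircle Ω A B C) (hiso : IsIsogonalConjugate A B C P P')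
    (hH : H.Through A B C P P') (hDΩ : D ∈ Ω) (hDH : D ∈ H) (hDA : D ≠ A) (hDB : D ≠ B)
    (hDC : D ≠ C) (hDP : D ≠ P) (hDP' : D ≠ P') :
    ∃ g : ℂ, IsogonalConfig (unitCoord Ω A) (unitCoord Ω B) (unitCoord Ω C) (unitCoord Ω D) g
      (unitCoord Ω P) (unitCoord Ω P') := by
  have hs := hΩ.radius_pos
  have inj : ∀ {p q : Plane}, p ≠ q → unitCoord Ω p ≠ unitCoord Ω q :=
    fun h => (unitCoord_injective hs).ne h
  obtain ⟨hAB, hBC, hCA⟩ := hΩ.ne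
  have hA := unitCoord_mul_conj hs hΩ.2.1
  have hB := unitCoord_mul_conj hs hΩ.2.2.1
  have hC := unitCoord_mul_conj hs hΩ.2.2.2
  have hD := unitCoord_mul_conj hs hDΩ
  have vA := isogonal_vertex hA hB hC (inj hAB) (inj hCA.symm)
    (hiso.angle_A.unitCoord hs rfl rfl rfl rfl rfl rfl)
  have vB := isogonal_vertex hB hC hA (inj hBC) (inj hAB.symm)
    (hiso.angle_B.unitCoord hs rfl rfl rfl rfl rfl rfl)
  obtain ⟨h₁, h₂⟩ := isogonal_relations (e₁ := unitCoord Ω A + unitCoord Ω B + unitCoord Ω C)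
    (e₂ := unitCoord Ω A * unitCoord Ω B + unitCoord Ω B * unitCoord Ω C +
      unitCoord Ω C * unitCoord Ω A) (e₃ := unitCoord Ω A * unitCoord Ω B * unitCoord Ω C)
    (inj hAB) vA (by linear_combination vB)
  have h₁' : unitCoord Ω A + unitCoord Ω B + unitCoord Ω C = unitCoord Ω P' + unitCoord Ω P +
      unitCoord Ω A * unitCoord Ω B * unitCoord Ω C *
        (conj (unitCoord Ω P') * conj (unitCoord Ω P)) := by linear_combination h₁
  have h₂' : unitCoord Ω A * unitCoord Ω B + unitCoord Ω B * unitCoord Ω C +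
      unitCoord Ω C * unitCoord Ω A = unitCoord Ω A * unitCoord Ω B * unitCoord Ω C *
        (conj (unitCoord Ω P') + conj (unitCoord Ω P)) + unitCoord Ω P' * unitCoord Ω P := by
    linear_combination h₂
  have off : ∀ {R : Plane}, OffSides A B C R → unitCoord Ω R ≠ unitCoord Ω A ∧
      unitCoord Ω R ≠ unitCoord Ω B ∧ unitCoord Ω R ≠ unitCoord Ω C := by
    rintro R ⟨r1, r2, -⟩
    refine ⟨inj ?_, inj ?_, inj ?_⟩
    · rintro rfl; exact r1 (left_mem_affineSpan_pair ℝ _ _)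
    · rintro rfl; exact r1 (right_mem_affineSpan_pair ℝ _ _)
    · rintro rfl; exact r2 (right_mem_affineSpan_pair ℝ _ _)
  have hp : unitCoord Ω P * conj (unitCoord Ω P) ≠ 1 := by
    intro h
    have := off hiso.offSides_left
    rcases vertex_of_isogonal_of_unit h₁ h₂ h with h | h | h <;> tauto
  have hp' : unitCoord Ω P' * conj (unitCoord Ω P') ≠ 1 := by
    intro h
    have := off hiso.offSides_right
    rcases vertex_of_isogonal_of_unit h₁' h₂' h with h | h | h <;> tauto
  have hd0 := left_ne_zero_of_mul_eq_one hD
  have ne : ∀ {R : Plane}, D ≠ R → 1 - unitCoord Ω D * conj (unitCoord Ω R) ≠ 0 := by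
    intro R hR h
    refine inj hR ((starRingEnd ℂ).injective (mul_left_cancel₀ hd0 ?_))
    linear_combination hD + h
  obtain ⟨hHA, hHB, hHC, hHP, hHP'⟩ := hH
  obtain ⟨U, hU, heval, -⟩ := Conic.form_of_through hs rfl rfl rfl rfl rfl hA hB hC hD (inj hAB)
    (inj hBC) (inj hCA) (inj hDA) (inj hDB) (inj hDC) h₁ h₂ hp hHA hHB hHC hDH hHP
  have hP' := heval P' _ _ rfl rfl
  rw [show H.eval P' = 0 from hHP', Complex.ofReal_zero, eq_comm] at hP'
  -- The second computation, from `P'`; the equation is already divided by its leading coefficient,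
  -- hence U = 1.
  have hW := conic_coeff_of_isogonal (U := 1) (d := unitCoord Ω D) h₁' h₂' hp'
    (W := unitCoord Ω A * unitCoord Ω B * unitCoord Ω C * conj (unitCoord Ω P') +
      unitCoord Ω D * unitCoord Ω P')
    (by linear_combination (mul_eq_zero.1 hP').resolve_left hU)
  refine ⟨unitCoord Ω A * unitCoord Ω B * unitCoord Ω C / unitCoord Ω D, hA, hB, hC, hD, h₁, h₂,
    by field_simp, ?_, hp, hp', ne hDP, ne hDP'⟩
  field_simp
  linear_combination hW

theorem circleForm_eq {Ω γ : Sphere Plane} (hΩ : 0 < Ω.radius) {P X Y : Plane}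
    (hγ : IsCircumcircle γ P X Y) (hX : X ∈ Ω) (hY : Y ∈ Ω) :
    ∃ t : ℂ, ∀ q : Plane, (circleForm γ q : ℂ) = Ω.radius ^ 2 *
      (unitCoord Ω q * conj (unitCoord Ω q) - 1 + t * (unitCoord Ω q +
        unitCoord Ω X * unitCoord Ω Y * conj (unitCoord Ω q) - unitCoord Ω X -
        unitCoord Ω Y)) := by
  have hr : (Ω.radius : ℂ) ^ 2 ≠ 0 := pow_ne_zero 2 (by exact_mod_cast hΩ.ne')
  obtain ⟨F, G, k, h⟩ := Sphere.exists_complex_form hΩ γ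
  have zero : ∀ q ∈ γ, unitCoord Ω q * conj (unitCoord Ω q) - 1 + F * unitCoord Ω q +
      G * conj (unitCoord Ω q) + k = 0 := by
    intro q hq
    have h1 := h q _ _ rfl rfl
    have h2 := circleForm_eq_zero_of_mem hγ.radius_pos hq
    rw [circleForm] at h2
    rw [h2, Complex.ofReal_zero, eq_comm] at h1
    exact (mul_eq_zero.1 h1).resolve_left hr
  obtain ⟨rfl, rfl⟩ := circle_coeffs_of_two_unit (unitCoord_mul_conj hΩ hX)
    (unitCoord_mul_conj hΩ hY) ((unitCoord_injective hΩ).ne hγ.ne.2.1) (zero X hγ.2.2.1)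
    (zero Y hγ.2.2.2)
  refine ⟨F, fun q => ?_⟩
  rw [circleForm, h q _ _ rfl rfl]
  ring

theorem lineForm_eq {Ω : Sphere Plane} (hΩ : 0 < Ω.radius) {P P' q : Plane} {g : ℂ}
    (hg : unitCoord Ω P' - unitCoord Ω P =
      g * (conj (unitCoord Ω P) - conj (unitCoord Ω P'))) :
    (lineForm P P' q : ℂ) = Ω.radius ^ 2 * (Complex.I / 2) *
      (conj (unitCoord Ω P') - conj (unitCoord Ω P)) *
      (unitCoord Ω q + g * conj (unitCoord Ω q) - unitCoord Ω P - g * conj (unitCoord Ω P)) := by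
  have key : (lineForm P P' q : ℂ) = Ω.radius ^ 2 * (Complex.I / 2) *
      ((conj (unitCoord Ω P') - conj (unitCoord Ω P)) * (unitCoord Ω q - unitCoord Ω P) -
        (unitCoord Ω P' - unitCoord Ω P) * (conj (unitCoord Ω q) - conj (unitCoord Ω P))) := by
    have hr := hΩ.ne'
    simp only [← map_sub, unitCoord_sub]
    apply Complex.ext
    · simp [lineForm, pow_two]
      field_simp
      ring
    · simp [lineForm, pow_two]
  rw [key]
  linear_combination -(Ω.radius ^ 2 * (Complex.I / 2) *
    (conj (unitCoord Ω q) - conj (unitCoord Ω P))) * hg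

theorem IsSecondIntersection.mem {s : Sphere Plane} {P Q R : Plane}
    (h : IsSecondIntersection s P Q R) : R ∈ s := by
  obtain ⟨hP, -, rfl⟩ := h
  exact (Sphere.secondInter_mem _).2 hP

/-! ### Tangency of the circle and the conic. -/

/-- The circle `PXY` is tangent at `P` and `Z` to the conic `ABCPZ`. -/
theorem tangent_circle {A B C P P' D X Y Z : Plane} {Ω γ : Sphere Plane} {g : ℂ}
    (hΩ : IsCircumcircle Ω A B C) (hPP' : P ≠ P')
    (cfg : IsogonalConfig (unitCoord Ω A) (unitCoord Ω B) (unitCoord Ω C) (unitCoord Ω D) g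
      (unitCoord Ω P) (unitCoord Ω P'))
    (hX : IsSecondIntersection Ω D P X) (hY : IsSecondIntersection Ω D P' Y)
    (hγ : IsCircumcircle γ P X Y) (hZ : IsSecondIntersection γ P P' Z) (hZP : Z ≠ P) {E : Conic}
    (hE : E.Through A B C P Z) : E.IsTangentToCircleAt γ P ∧ E.IsTangentToCircleAt γ Z := by
  have hs := hΩ.radius_pos
  have hr : (Ω.radius : ℂ) ^ 2 ≠ 0 := pow_ne_zero 2 (by exact_mod_cast hs.ne')
  have hXΩ := hX.mem
  have hYΩ := hY.mem
  have hZγ := hZ.mem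
  have hxy := (unitCoord_injective hs).ne hγ.ne.2.1
  have hx := unitCoord_secondInter hs hX
  have hy := unitCoord_secondInter hs hY
  obtain ⟨t, ht⟩ := circleForm_eq hs hγ hXΩ hYΩ
  have hl : ∀ q, _ := fun q => lineForm_eq (q := q) hs cfg.sub_eq
  have hg : g ≠ 0 := by
    rintro rfl
    have := cfg.sub_eq
    rw [zero_mul, sub_eq_zero] at this
    exact hPP' (unitCoord_injective hs this.symm)
  have hQP : conj (unitCoord Ω P') - conj (unitCoord Ω P) ≠ 0 := by
    rw [← map_sub, Ne, map_eq_zero, sub_eq_zero]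
    exact (unitCoord_injective hs).ne hPP'.symm
  have line_ne : ∀ {q : Plane}, unitCoord Ω q + g * conj (unitCoord Ω q) - unitCoord Ω P -
      g * conj (unitCoord Ω P) ≠ 0 → lineForm P P' q ≠ 0 := by
    intro q h h0
    have := hl q
    rw [h0, Complex.ofReal_zero, eq_comm] at this
    simp [hs.ne', hQP, h] at this
  have hlA := line_ne (cfg.line_eval_ne_zero hx hy hxy)
  have hlB := line_ne (cfg.rotate.line_eval_ne_zero hx hy hxy)
  have hlC := line_ne (cfg.rotate.rotate.line_eval_ne_zero hx hy hxy)
  have hκ : g * ((1 - unitCoord Ω D * conj (unitCoord Ω P)) *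
      (1 - unitCoord Ω D * conj (unitCoord Ω P'))) ≠ 0 :=
    mul_ne_zero hg (mul_ne_zero cfg.left_ne cfg.right_ne)
  have vertex : ∀ {q : Plane} {b c : ℂ},
      IsogonalConfig (unitCoord Ω q) b c (unitCoord Ω D) g (unitCoord Ω P) (unitCoord Ω P') →
      (circleForm γ q : ℂ) * (g * ((1 - unitCoord Ω D * conj (unitCoord Ω P)) *
        (1 - unitCoord Ω D * conj (unitCoord Ω P')))) * (Ω.radius ^ 2 * (Complex.I / 2) *
        (conj (unitCoord Ω P') - conj (unitCoord Ω P))) ^ 2 =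
      Ω.radius ^ 2 * (t * unitCoord Ω D) * (lineForm P P' q : ℂ) ^ 2 := by
    intro q b c h
    have h1 := circle_eval_vertex (t := t) h.unit_a h.e₁ h.e₂ h.e₃ h.sub_eq hx hy
    rw [ht, hl]
    linear_combination (Ω.radius ^ 2 * (Ω.radius ^ 2 * (Complex.I / 2) *
        (conj (unitCoord Ω P') - conj (unitCoord Ω P))) ^ 2) * h1
  have hκ' : g * ((1 - unitCoord Ω D * conj (unitCoord Ω P)) *
      (1 - unitCoord Ω D * conj (unitCoord Ω P'))) * (Ω.radius ^ 2 * (Complex.I / 2) *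
        (conj (unitCoord Ω P') - conj (unitCoord Ω P))) ^ 2 ≠ 0 :=
    mul_ne_zero hκ (pow_ne_zero 2 (mul_ne_zero (mul_ne_zero hr (by simp)) hQP))
  -- The factor in `vertex` is complex, so its ratio at q and `A` is used instead; this gives a real
  -- μ common to all vertices.
  have cross : ∀ {q : Plane} {b c : ℂ},
      IsogonalConfig (unitCoord Ω q) b c (unitCoord Ω D) g (unitCoord Ω P) (unitCoord Ω P') →
      circleForm γ q = circleForm γ A / lineForm P P' A ^ 2 * lineForm P P' q ^ 2 := by
    intro q b c h
    have h1 : (circleForm γ q : ℂ) * (lineForm P P' A : ℂ) ^ 2 =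
        circleForm γ A * (lineForm P P' q : ℂ) ^ 2 := by
      apply mul_left_cancel₀ hκ'
      linear_combination (lineForm P P' A : ℂ) ^ 2 * vertex h -
        (lineForm P P' q : ℂ) ^ 2 * vertex cfg
    have h2 : circleForm γ q * lineForm P P' A ^ 2 =
        circleForm γ A * lineForm P P' q ^ 2 := by exact_mod_cast h1
    field_simp
    linear_combination h2
  obtain ⟨-, -, hZdef⟩ := hZ
  rw [Sphere.secondInter] at hZdef
  -- Only the fact that this parameter is nonzero, equivalent to `Z ≠ P`, matters from here on.
  generalize -2 * inner ℝ (P' -ᵥ P) (P -ᵥ γ.center) / inner ℝ (P' -ᵥ P) (P' -ᵥ P) = τ at hZdef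
  have hτ : τ ≠ 0 := by
    rintro rfl
    simp at hZdef
    exact hZP hZdef
  have hZ0 : Z 0 = P 0 + τ * (P' 0 - P 0) := by rw [hZdef]; simp; ring
  have hZ1 : Z 1 = P 1 + τ * (P' 1 - P 1) := by rw [hZdef]; simp; ring
  obtain ⟨k, hk, h1, h2, h3, h4⟩ := Conic.grad_eq_of_pencil hΩ.cross_ne_zero hPP' hτ hZ0 hZ1
    (circleForm_eq_zero_of_mem hγ.radius_pos hγ.2.1)
    (circleForm_eq_zero_of_mem hγ.radius_pos hZγ) (cross cfg) (cross cfg.rotate)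
    (cross cfg.rotate.rotate) hlA hlB hlC hE
  exact ⟨Conic.isTangentToCircleAt_of_grad hγ.radius_pos hE.2.2.2.1 hγ.2.1 hk h1 h2,
    Conic.isTangentToCircleAt_of_grad hγ.radius_pos hE.2.2.2.2 hZγ hk h3 h4⟩

/-! ### Tangency of the line. -/

/-- The line `Z₁'Z₂'` is tangent at `P'` to the conic `ABCPP'`. -/
theorem tangent_line {A B C P P' D X Y : Plane} {Ω γ : Sphere Plane} {H K : Conic} {g : ℂ}
    (hΩ : IsCircumcircle Ω A B C) (hP' : OffSides A B C P')
    (cfg : IsogonalConfig (unitCoord Ω A) (unitCoord Ω B) (unitCoord Ω C) (unitCoord Ω D) g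
      (unitCoord Ω P) (unitCoord Ω P'))
    (hH : H.Through A B C P P') (hDH : D ∈ H) (hDA : D ≠ A) (hDB : D ≠ B)
    (hDC : D ≠ C)
    (hX : IsSecondIntersection Ω D P X) (hY : IsSecondIntersection Ω D P' Y)
    (hγ : IsCircumcircle γ P X Y) (hK : K.Through A B C P X) {Z₁ Z₂ Z₁' Z₂' : Plane}
    (hZ : Z₁ ≠ Z₂) (h1γ : Z₁ ∈ γ) (h1K : Z₁ ∈ K) (h1P : Z₁ ≠ P) (h1X : Z₁ ≠ X)
    (h2γ : Z₂ ∈ γ) (h2K : Z₂ ∈ K) (h2P : Z₂ ≠ P) (h2X : Z₂ ≠ X)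
    (hZ₁ : IsSecondIntersection Ω X Z₁ Z₁') (hZ₂ : IsSecondIntersection Ω X Z₂ Z₂') :
    H.IsTangentLineAt P' line[ℝ, Z₁', Z₂'] := by
  have hs := hΩ.radius_pos
  have hr : (Ω.radius : ℂ) ^ 2 ≠ 0 := pow_ne_zero 2 (by exact_mod_cast hs.ne')
  have hXΩ := hX.mem
  have hYΩ := hY.mem
  have inj : ∀ {p q : Plane}, p ≠ q → unitCoord Ω p ≠ unitCoord Ω q :=
    fun h => (unitCoord_injective hs).ne h
  obtain ⟨hPX, hXY, hYP⟩ := hγ.ne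
  have hxy := inj hXY
  have hx := unitCoord_secondInter hs hX
  have hy := unitCoord_secondInter hs hY
  have hX1 := unitCoord_mul_conj hs hXΩ
  obtain ⟨t, ht⟩ := circleForm_eq hs hγ hXΩ hYΩ
  have circ : ∀ q ∈ γ, unitCoord Ω q * conj (unitCoord Ω q) - 1 + t * (unitCoord Ω q +
      unitCoord Ω X * unitCoord Ω Y * conj (unitCoord Ω q) - unitCoord Ω X -
      unitCoord Ω Y) = 0 := by
    intro q hq
    have h1 := ht q
    rw [circleForm_eq_zero_of_mem hγ.radius_pos hq, Complex.ofReal_zero, eq_comm] at h1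
    exact (mul_eq_zero.1 h1).resolve_left hr
  have hdt := circle_param cfg.unit_p hx (circ P hγ.2.1)
  obtain ⟨hAB, hBC, hCA⟩ := hΩ.ne
  have hd0 := left_ne_zero_of_mul_eq_one cfg.unit_d
  -- For `H`, the roles of `P` and `P'` are exchanged, so that the tangent at `P'` is expressed
  -- through p.
  obtain ⟨U, hU, -, hgrad⟩ := Conic.form_of_through hs rfl rfl rfl rfl rfl cfg.unit_a cfg.unit_b
    cfg.unit_c cfg.unit_d (inj hAB) (inj hBC) (inj hCA) (inj hDA) (inj hDB) (inj hDC)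
    (p := unitCoord Ω P') (q := unitCoord Ω P) (Q := conj (unitCoord Ω P))
    (by linear_combination cfg.e₁) (by linear_combination cfg.e₂) cfg.unit_q hH.1 hH.2.1
    hH.2.2.1 hDH hH.2.2.2.2
  -- For `K`, the fourth point on `Ω` is `X` instead of `D`, which requires `X` to differ from the
  -- vertices.
  obtain ⟨U', hU', heval, -⟩ := Conic.form_of_through hs rfl rfl rfl rfl rfl cfg.unit_a cfg.unit_b
    cfg.unit_c hX1 (inj hAB) (inj hBC) (inj hCA) (cfg.second_inter_ne_vertex hx hy hxy)
    (cfg.rotate.second_inter_ne_vertex hx hy hxy)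
    (cfg.rotate.rotate.second_inter_ne_vertex hx hy hxy) cfg.e₁ cfg.e₂ cfg.unit_p hK.1 hK.2.1
    hK.2.2.1 hK.2.2.2.2 hK.2.2.2.1
  have h₁ := cfg.e₁
  have h₂ := cfg.e₂
  rw [cfg.e₃] at h₁ h₂
  have main : ∀ {Z Z' : Plane}, Z ∈ γ → Z ∈ K → Z ≠ P → Z ≠ X → IsSecondIntersection Ω X Z Z' →
      unitCoord Ω Z' * (1 + t * unitCoord Ω X) =
        unitCoord Ω Z + t * (unitCoord Ω X * unitCoord Ω Y) ∧
      H.gradX P' * (Z' 0 - P' 0) + H.gradY P' * (Z' 1 - P' 1) = 0 := by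
    intro Z Z' hZγ hZK hZP hZX hZ'
    have hz := circ Z hZγ
    have hzx := sub_ne_zero.2 (inj hZX)
    have hk := heval Z _ _ rfl rfl
    rw [show K.eval Z = 0 from hZK, Complex.ofReal_zero, eq_comm] at hk
    have hk' := (mul_eq_zero.1 hk).resolve_left hU'
    rw [cfg.e₃] at hk'
    have hline := (mul_eq_zero.1 (common_points_collinear h₁ h₂ hx hy hdt hz hk')).resolve_left
      (by
        intro h
        rcases eq_of_circle_of_line (F := t) (G := t * (unitCoord Ω X * unitCoord Ω Y))
          (m := -(t * (unitCoord Ω X + unitCoord Ω Y))) hX1 hd0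
          (by linear_combination circ P hγ.2.1) (by linear_combination circ X hγ.2.2.1)
          (by linear_combination hz) hx (inj hPX) h with h | h
        · exact inj hZP h
        · exact inj hZX h)
    have hw := unitCoord_secondInter hs hZ'
    have hw' := congrArg conj hw
    simp only [map_mul, map_sub, map_one, Complex.conj_conj] at hw'
    have hne : 1 - unitCoord Ω X * conj (unitCoord Ω Z) ≠ 0 := by
      intro h
      rw [h, mul_zero] at hw
      exact hzx hw.symm
    -- Z ↦ Z' is the restriction to `γ` of an affine map in z alone that fixes y: the spiral
    -- similarity about `Y`. The formula `hTt` plays the part of its conjugate.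
    have hwt : unitCoord Ω Z' * (1 + t * unitCoord Ω X) =
        unitCoord Ω Z + t * (unitCoord Ω X * unitCoord Ω Y) := by
      apply mul_left_cancel₀ hne
      linear_combination (1 + t * unitCoord Ω X) * hw + unitCoord Ω X * hz
    have hTt : conj (unitCoord Ω Z') * (1 + t * unitCoord Ω Y) = conj (unitCoord Ω Z) + t := by
      apply mul_left_cancel₀ hzx
      linear_combination (-(1 + t * unitCoord Ω Y) * unitCoord Ω X) * hw' -
        (1 + t * unitCoord Ω Y) * (conj (unitCoord Ω Z') * unitCoord Ω Z - 1) * hX1 - hz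
    refine ⟨hwt, ?_⟩
    have hT := tangent_eval_eq_zero h₁ h₂ hx hy hdt hwt hTt hline
    have := hgrad P' Z' _ _ _ _ rfl rfl rfl rfl
    rw [cfg.e₃] at this
    have h0 : ((H.gradX P' * (Z' 0 - P' 0) + H.gradY P' * (Z' 1 - P' 1) : ℝ) : ℂ) = 0 := by
      rw [this]
      linear_combination U * hT
    exact_mod_cast h0
  obtain ⟨hw₁, hl₁⟩ := main h1γ h1K h1P h1X hZ₁
  obtain ⟨hw₂, hl₂⟩ := main h2γ h2K h2P h2X hZ₂
  -- The formula `hwt` recovers z from Z', so equal images would force `Z₁ = Z₂`.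
  have hne : Z₁' ≠ Z₂' := by
    rintro rfl
    refine inj hZ ?_
    linear_combination hw₂ - hw₁
  have hsm := Conic.smooth_of_offSides hAB hBC hCA hH.1 hH.2.1 hH.2.2.1 hH.2.2.2.2 hP'
  exact ⟨hH.2.2.2.2, hsm, Plane.mem_line_iff_of_normal hsm hne hl₁ hl₂⟩

theorem theorem1p2
    (A B C P P' D X Y Z : Plane) (Ω γ : Sphere Plane) (H : Conic)
    (hΩ : IsCircumcircle Ω A B C)
    (hiso : IsIsogonalConjugate A B C P P') (hPP' : P ≠ P')
    (hH : H.Through A B C P P')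
    (hDΩ : D ∈ Ω) (hDH : D ∈ H) (hDA : D ≠ A) (hDB : D ≠ B) (hDC : D ≠ C)
    (hX : IsSecondIntersection Ω D P X)
    (hY : IsSecondIntersection Ω D P' Y)
    (hγ : IsCircumcircle γ P X Y)
    (hZ : IsSecondIntersection γ P P' Z) :
    (Z ≠ P → ∀ E : Conic, E.Through A B C P Z →
      E.IsTangentToCircleAt γ P ∧ E.IsTangentToCircleAt γ Z) ∧
    (∀ K : Conic, K.Through A B C P X →
      ∀ Z₁ Z₂ Z₁' Z₂' : Plane, Z₁ ≠ Z₂ →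
        Z₁ ∈ γ → Z₁ ∈ K → Z₁ ≠ P → Z₁ ≠ X →
        Z₂ ∈ γ → Z₂ ∈ K → Z₂ ≠ P → Z₂ ≠ X →
        IsSecondIntersection Ω X Z₁ Z₁' → IsSecondIntersection Ω X Z₂ Z₂' →
        H.IsTangentLineAt P' line[ℝ, Z₁', Z₂']) := by
  obtain ⟨g, cfg⟩ := isogonalConfig_of_conic hΩ hiso hH hDΩ hDH hDA hDB hDC hX.2.1 hY.2.1
  refine ⟨fun hZP E hE => tangent_circle hΩ hPP' cfg hX hY hγ hZ hZP hE, ?_⟩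
  intro K hK Z₁ Z₂ Z₁' Z₂' hne h1γ h1K h1P h1X h2γ h2K h2P h2X hZ₁ hZ₂
  exact tangent_line hΩ hiso.offSides_right cfg hH hDH hDA hDB hDC hX hY hγ hK hne h1γ h1K
    h1P h1X h2γ h2K h2P h2X hZ₁ hZ₂
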